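/- Notation. Let $P_n$ ($n\ge 1$) be the orthogonal projection of $\ell^2(\mathbb Z^+)$, $\mathbb Z^+=\{0,1,2,\dots\}$, onto the span of the first $n$ standard basis vectors, and let $P$ be the orthogonal projection of $\ell^2(\mathbb Z)$ onto $\ell^2(\mathbb Z^+)$. For $a\in L^\infty(\mathbb T)$ with Fourier coefficients $a_k$ let $L(a)=(a_{i-j})_{i,j\in\mathbb Z}$ be the Laurent operator on $\ell^2(\mathbb Z)$ and $T(a)=PL(a)P$ the Toeplitz operator on $\ell^2(\mathbb Z^+)$. Let $AP(\mathbb Z)$ be the set of all $b\in\ell^\infty(\mathbb Z)$ whose set of translates $\{b(\cdot+k):k\in\mathbb Z\}$ is relatively compact in $\ell^\infty(\mathbb Z)$, and let $\mathcal A=\mathcal A_{L^\infty(\mathbb T),AP(\mathbb Z)}(\mathbb Z^+)$ be the smallest closed $C^*$-subalgebra of $L(\ell^2(\mathbb Z^+))$ containing all $T(a)$ with $a\in L^\infty(\mathbb T)$ and all $PbP$ with $b\in AP(\mathbb Z)$ (acting as multiplication by $b|_{\mathbb Z^+}$). Let $\mathcal F$ be the $C^*$-algebra of all sequences $\mathbf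 A=(A_n)_{n\ge1}$ of operators $A_n:\operatorname{im}P_n\to\operatorname{im}P_n$ for which the strong limits of $A_nP_n$ and of $A_n^*P_n$ on $\ell^2(\mathbb Z^+)$ exist, with entrywise operations and the norm $\sup_n\|A_n\|$, and write $W(\mathbf A)=\operatorname{s-lim}A_nP_n$. Let $\mathcal S=\mathcal S_{L^\infty(\mathbb T),AP(\mathbb Z)}(\mathbb Z^+)$ be the smallest closed $C^*$-subalgebra of $\mathcal F$ containing all sequences $(P_nAP_n)_{n\ge1}$ with $A\in\mathcal A$. For an operator $B$ on $\ell^2(\mathbb Z^+)$ let $D(B)=(b_{nn})_{n\ge0}$ be its main diagonal; if there is exactly one $f\in AP(\mathbb Z)$ such that $b_{nn}-f(n)\to0$ as $n\to+\infty$, it is denoted by $D_{ap}(B)$ and called the almost periodic part of the main diagonal. The mean value of $f\in AP(\mathbb Z)$ is $M(f)=\lim_{n\to\infty}\frac1n\sum_{r=0}^{n-1}f(r)$. Theorem. Let $\mathbf A=(A_n)\in\mathcal S$. Then $W(\mathbf A)\in\mathcal A$, the almost periodic part $D_{ap}(W(\mathbf A))$ exists and is unique, its mean value exists, and $$\lim_{n\to\infty}\frac{\lambda_1(A_n)+\dots+\lambda_n(A_n)}{n}=M\bigl(D_{ap}(W(\mathbf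 A))\bigr),$$ where $\lambda_1(A_n),\dots,\lambda_n(A_n)$ are the eigenvalues of $A_n$, counted with algebraic multiplicity. -/

import Mathlib

open Filter Topology MeasureTheory
open scoped ENNReal lp BoundedContinuousFunction

noncomputable section

namespace SzegoAP

/-! ### Operators on `ℓ²(ℤ)` and `ℓ²(ℤ⁺)`, where `ℤ⁺ = {0, 1, 2, …}` is modelled by `ℕ` -/

/-- The C⋆-algebra of all bounded linear operators on `ℓ²(ℤ)`. -/
abbrev OpZ : Type := ℓ²(ℤ, ℂ) →L[ℂ] ℓ²(ℤ, ℂ)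

/-- The C⋆-algebra of all bounded linear operators on `ℓ²(ℤ⁺)`. -/
abbrev OpN : Type := ℓ²(ℕ, ℂ) →L[ℂ] ℓ²(ℕ, ℂ)

/-- The standard basis vectors of `ℓ²(ℤ)`. -/
def eZ (k : ℤ) : ℓ²(ℤ, ℂ) := lp.single 2 k (1 : ℂ)

/-- The standard basis vectors of `ℓ²(ℤ⁺)`. -/
def eN (k : ℕ) : ℓ²(ℕ, ℂ) := lp.single 2 k (1 : ℂ)

/-- The restriction `ℓ²(ℤ) → ℓ²(ℤ⁺)`, `(x_n)_{n ∈ ℤ} ↦ (x_n)_{n ≥ 0}`. Its adjoint is extension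
by zero, i.e. the identification of `ℓ²(ℤ⁺)` with a closed subspace of `ℓ²(ℤ)`. -/
def restr : ℓ²(ℤ, ℂ) →L[ℂ] ℓ²(ℕ, ℂ) :=
  LinearMap.mkContinuous
    { toFun := fun x => ⟨fun n : ℕ => x (n : ℤ), by
        have h := (lp.memℓp x).summable (by norm_num)
        exact memℓp_gen (h.comp_injective Nat.cast_injective)⟩
      map_add' := fun x y => by ext n; rfl
      map_smul' := fun c x => by ext n; rfl } 1 (by
    intro x
    rw [one_mul]
    have h := (lp.memℓp x).summable (by norm_num : 0 < (2 : ℝ≥0∞).toReal)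
    refine lp.norm_le_of_tsum_le (by norm_num) (norm_nonneg x) ?_
    rw [lp.norm_rpow_eq_tsum (by norm_num) x]
    exact (h.comp_injective Nat.cast_injective).tsum_le_tsum_of_inj (fun n : ℕ => (n : ℤ))
      Nat.cast_injective (fun c _ => by positivity) (fun n => le_rfl) h)

/-- The compression `PAP`, acting on `ℓ²(ℤ⁺)`, of an operator `A` on `ℓ²(ℤ)`. -/
def compress (A : OpZ) : OpN := restr ∘L A ∘L restr.adjoint

/-! ### Laurent, Toeplitz and multiplication operators -/

instance factTwoPiPos : Fact (0 < 2 * Real.pi) := ⟨Real.two_pi_pos⟩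

/-- The unit circle `𝕋`, parametrized by `t ↦ e^{it}`, `t ∈ ℝ / 2πℤ`. -/
abbrev Circ : Type := AddCircle (2 * Real.pi)

/-- `L^∞(𝕋)` (with respect to the normalized arc length measure). -/
abbrev LInf : Type := Lp ℂ ∞ (AddCircle.haarAddCircle : Measure Circ)

/-- `L²(𝕋)`. -/
abbrev LTwo : Type := Lp ℂ 2 (AddCircle.haarAddCircle : Measure Circ)

/-- The operator `f ↦ a f` of multiplication by `a ∈ L^∞(𝕋)` on `L²(𝕋)`. -/
def mulLTwo (a : LInf) : LTwo →L[ℂ] LTwo :=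
  (ContinuousLinearMap.mul ℂ ℂ).holderL AddCircle.haarAddCircle ∞ 2 2 a

/-- The Laurent operator `L(a)` on `ℓ²(ℤ)`: multiplication by `a`, transported to `ℓ²(ℤ)` by the
Fourier transform. Its matrix is `(a_{i-j})`, see `laurent_entry`. -/
def laurent (a : LInf) : OpZ :=
  (fourierBasis (T := 2 * Real.pi)).repr.toContinuousLinearEquiv.toContinuousLinearMap ∘L
    mulLTwo a ∘L
      (fourierBasis (T := 2 * Real.pi)).repr.symm.toContinuousLinearEquiv.toContinuousLinearMap

/-- The matrix of the Laurent operator `L(a)` is `(a_{i-j})_{i,j ∈ ℤ}`, with `a_k` the Fourier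
coefficients of `a`. -/
theorem laurent_entry (a : LInf) (i j : ℤ) :
    (laurent a (eZ j) : ℤ → ℂ) i = fourierCoeff (a : Circ → ℂ) (i - j) := by
  have h1 : laurent a (eZ j) = fourierBasis.repr (mulLTwo a (fourierLp 2 j)) := by
    have : (fourierBasis (T := 2 * Real.pi)).repr.symm (eZ j) = fourierLp 2 j := by
      rw [eZ, HilbertBasis.repr_symm_single, coe_fourierBasis]
    simp only [laurent, ContinuousLinearMap.comp_apply]
    rw [← this]
    rfl
  rw [h1, fourierBasis_repr]
  refine integral_congr_ae ?_
  have h2 := ContinuousLinearMap.coeFn_holder (r := 2) (ContinuousLinearMap.mul ℂ ℂ) a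
    (fourierLp (T := 2 * Real.pi) 2 j)
  filter_upwards [h2, coeFn_fourierLp (T := 2 * Real.pi) 2 j] with t ht hf
  have h3 : (mulLTwo a (fourierLp 2 j) : Circ → ℂ) t = a t * fourier j t := by
    have : (mulLTwo a (fourierLp 2 j) : Circ → ℂ) t
      = ((ContinuousLinearMap.mul ℂ ℂ).holder 2 a (fourierLp (T := 2 * Real.pi) 2 j) :
          LTwo) t := rfl
    rw [this, ht, hf]
    rfl
  rw [h3, neg_sub, sub_eq_add_neg, fourier_add]
  simp only [smul_eq_mul]
  ring

/-- The Toeplitz operator `T(a) = P L(a) P` on `ℓ²(ℤ⁺)`. -/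
def toeplitz (a : LInf) : OpN := compress (laurent a)

/-- The multiplication operator `bI : (x_n) ↦ (b_n x_n)` on `ℓ²(ℤ)`, for a bounded sequence
`b ∈ ℓ^∞(ℤ)`; the latter space is modelled by `ℤ →ᵇ ℂ` (with the supremum norm). -/
def mulOp (b : ℤ →ᵇ ℂ) : OpZ :=
  LinearMap.mkContinuous
    { toFun := fun x => ⟨fun n : ℤ => b n * x n, by
        have h := ((lp.memℓp x).summable (by norm_num)).mul_left (‖b‖ ^ (2 : ℝ≥0∞).toReal)
        refine memℓp_gen (h.of_nonneg_of_le (fun n => by positivity) fun n => ?_)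
        rw [norm_mul, Real.mul_rpow (norm_nonneg _) (norm_nonneg _)]
        gcongr
        exact b.norm_coe_le_norm n⟩
      map_add' := fun x y => by ext n; exact mul_add _ _ _
      map_smul' := fun c x => by ext n; exact mul_left_comm _ _ _ } ‖b‖ (by
    intro x
    have h := (lp.memℓp x).summable (by norm_num : 0 < (2 : ℝ≥0∞).toReal)
    refine lp.norm_le_of_forall_sum_le (by norm_num) (by positivity) fun s => ?_
    rw [Real.mul_rpow (norm_nonneg _) (norm_nonneg _), lp.norm_rpow_eq_tsum (by norm_num) x]
    refine le_trans ?_ (mul_le_mul_of_nonneg_left (h.sum_le_tsum s fun n _ => by positivity)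
      (by positivity))
    rw [Finset.mul_sum]
    refine Finset.sum_le_sum fun n _ => ?_
    rw [← Real.mul_rpow (norm_nonneg _) (norm_nonneg _)]
    refine Real.rpow_le_rpow (norm_nonneg _) ?_ (by norm_num)
    change ‖b n * x n‖ ≤ _
    rw [norm_mul]
    gcongr
    exact b.norm_coe_le_norm n)

/-- The smallest closed C⋆-subalgebra of `L(ℓ²(ℤ⁺))` which contains all Toeplitz operators `T(a)`
with `a ∈ X` and all operators `PbP` with `b ∈ Y`. -/
def opAlg (X : Set LInf) (Y : Set (ℤ →ᵇ ℂ)) : StarSubalgebra ℂ OpN :=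
  (StarAlgebra.adjoin ℂ
    ({A | ∃ a ∈ X, A = toeplitz a} ∪ {A | ∃ b ∈ Y, A = compress (mulOp b)})).topologicalClosure

/-! ### Almost periodic functions on `ℤ` -/

/-- The translate `U_{-k} a`, i.e. `n ↦ a (n + k)`. -/
def translateFun (a : ℤ →ᵇ ℂ) (k : ℤ) : ℤ →ᵇ ℂ :=
  a.compContinuous ⟨fun n => n + k, continuous_of_discreteTopology⟩

/-- `AP(ℤ)`: the functions in `ℓ^∞(ℤ)` whose set of translates is relatively compact in the
norm topology. -/
def AP : Set (ℤ →ᵇ ℂ) := {a | IsCompact (closure (Set.range (translateFun a)))}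

/-- `(1/n) ∑_{r=0}^{n-1} a(r)`. -/
def arithMean (a : ℤ → ℂ) (n : ℕ+) : ℂ := (∑ r ∈ Finset.range n, a r) / (n : ℕ)

/-- The mean value `M(a)`, the limit of the arithmetic means. -/
def meanValue (a : ℤ → ℂ) : ℂ := limUnder atTop (arithMean a)

/-! ### Sequences of finite sections -/

/-- `im P_n`, the span of the first `n` basis vectors of `ℓ²(ℤ⁺)`. -/
def imP (n : ℕ+) : Submodule ℂ ℓ²(ℕ, ℂ) :=
  Submodule.span ℂ (eN '' (Finset.range n : Set ℕ))

instance finiteDimensional_imP (n : ℕ+) : FiniteDimensional ℂ (imP n) :=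
  FiniteDimensional.span_of_finite ℂ ((Finset.finite_toSet _).image _)

instance nontrivial_imP (n : ℕ+) : Nontrivial (imP n) := by
  refine ⟨⟨⟨eN 0, Submodule.subset_span ⟨0, by simp, rfl⟩⟩, 0, fun h => ?_⟩⟩
  have h1 : (eN 0 : ℕ → ℂ) 0 = 0 := by
    rw [show eN 0 = 0 from congrArg Subtype.val h]; rfl
  simp [eN] at h1

/-- The C⋆-algebra `L(im P_n)`. -/
abbrev OpIm (n : ℕ+) : Type := imP n →L[ℂ] imP n

instance cstarAlgebraOpIm (n : ℕ+) : CStarAlgebra (OpIm n) :=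
  instCStarAlgebraContinuousLinearMapComplexIdOfCompleteSpace

/-- The finite section `P_n A P_n` of `A`, acting on `im P_n`. -/
def finSec (A : OpN) (n : ℕ+) : OpIm n :=
  (imP n).orthogonalProjectionOnto ∘L A ∘L (imP n).subtypeL

/-- The operator `A_n P_n` on `ℓ²(ℤ⁺)`. -/
def extend (n : ℕ+) (A : OpIm n) : OpN :=
  (imP n).subtypeL ∘L A ∘L (imP n).orthogonalProjectionOnto

/-- `s-lim A_n P_n = B`. -/
def IsStrongLim (A : ∀ n, OpIm n) (B : OpN) : Prop :=
  ∀ x : ℓ²(ℕ, ℂ), Tendsto (fun n => extend n (A n) x) atTop (𝓝 (B x))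

/-- The projections `P_n` converge strongly to the identity. -/
theorem tendsto_proj (x : ℓ²(ℕ, ℂ)) :
    Tendsto (fun n => (imP n).starProjection x) atTop (𝓝 x) := by
  refine Submodule.starProjection_tendsto_self imP ?_ x ?_
  · intro m n hmn
    refine Submodule.span_mono (Set.image_mono ?_)
    intro k hk
    simp only [Finset.coe_range, Set.mem_Iio] at hk ⊢
    exact hk.trans_le hmn
  · intro y _
    have h := lp.hasSum_single (p := 2) (by norm_num) y
    refine mem_closure_of_tendsto h (Eventually.of_forall fun s => ?_)
    refine Submodule.sum_mem _ fun k _ => ?_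
    refine Submodule.mem_iSup_of_mem (⟨k + 1, k.succ_pos⟩ : ℕ+) ?_
    have : lp.single 2 k (y k) = y k • eN k := by
      rw [eN, ← lp.single_smul]; simp
    rw [this]
    exact Submodule.smul_mem _ _ (Submodule.subset_span ⟨k, by simp, rfl⟩)

theorem norm_extend_apply_le (n : ℕ+) (A : OpIm n) (x : ℓ²(ℕ, ℂ)) :
    ‖extend n A x‖ ≤ ‖A‖ * ‖x‖ := by
  refine (A.le_opNorm _).trans ?_
  gcongr
  exact (imP n).norm_orthogonalProjectionOnto_apply_le x

theorem IsStrongLim.add {A B : ∀ n, OpIm n} {S T : OpN} (hA : IsStrongLim A S)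
    (hB : IsStrongLim B T) : IsStrongLim (fun n => A n + B n) (S + T) :=
  fun x => (hA x).add (hB x)

theorem IsStrongLim.smul_one (c : ℂ) : IsStrongLim (fun n => c • (1 : OpIm n)) (c • 1) :=
  fun x => (tendsto_proj x).const_smul c

theorem IsStrongLim.mul {A B : ∀ n, OpIm n} {S T : OpN} {C : ℝ} (hC : ∀ n, ‖A n‖ ≤ C)
    (hA : IsStrongLim A S) (hB : IsStrongLim B T) :
    IsStrongLim (fun n => A n * B n) (S * T) := by
  intro x
  have h1 : ∀ n, extend n (A n * B n) x
      = extend n (A n) (extend n (B n) x - T x) + extend n (A n) (T x) := by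
    intro n
    rw [← map_add, sub_add_cancel]
    simp [extend]
  have h2 : Tendsto (fun n => extend n (A n) (extend n (B n) x - T x)) atTop (𝓝 0) := by
    have h3 : Tendsto (fun n => C * ‖extend n (B n) x - T x‖) atTop (𝓝 0) := by
      have := (tendsto_iff_norm_sub_tendsto_zero.1 (hB x)).const_mul C
      simpa using this
    refine squeeze_zero_norm (fun n => ?_) h3
    exact (norm_extend_apply_le n _ _).trans
      (mul_le_mul_of_nonneg_right (hC n) (norm_nonneg _))
  have h4 := h2.add (hA (T x))
  rw [zero_add] at h4
  exact h4.congr fun n => (h1 n).symm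

/-- Finite sections of `A` converge strongly to `A`. -/
theorem isStrongLim_finSec (A : OpN) : IsStrongLim (finSec A) A := by
  intro x
  have h1 : ∀ n, extend n (finSec A n) x
      = (imP n).starProjection (A ((imP n).starProjection x) - A x)
        + (imP n).starProjection (A x) := by
    intro n
    rw [← map_add, sub_add_cancel]
    rfl
  have h2 : Tendsto (fun n => (imP n).starProjection (A ((imP n).starProjection x) - A x))
      atTop (𝓝 0) := by
    have h3 := tendsto_iff_norm_sub_tendsto_zero.1 ((A.continuous.tendsto x).comp (tendsto_proj x))
    exact squeeze_zero_norm (fun n => (imP n).norm_starProjection_apply_le _) h3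
  have h4 := h2.add (tendsto_proj (A x))
  rw [zero_add] at h4
  exact h4.congr fun n => (h1 n).symm

theorem star_finSec (A : OpN) (n : ℕ+) : star (finSec A n) = finSec (star A) n := by
  simp only [ContinuousLinearMap.star_eq_adjoint]
  refine ((ContinuousLinearMap.eq_adjoint_iff _ _).2 fun x y => ?_).symm
  simp [finSec, ContinuousLinearMap.adjoint_inner_left]

theorem norm_finSec_le (A : OpN) (n : ℕ+) : ‖finSec A n‖ ≤ ‖A‖ := by
  refine ContinuousLinearMap.opNorm_le_bound _ (norm_nonneg _) fun x => ?_
  exact ((imP n).norm_orthogonalProjectionOnto_apply_le _).trans (A.le_opNorm _)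

/-- The C⋆-algebra of all bounded sequences `(A_n)` with `A_n ∈ L(im P_n)`, with entrywise
operations and involution and with the norm `sup_n ‖A_n‖`. -/
abbrev BddSeq : Type := lp OpIm ∞

/-- The C⋆-algebra `ℱ^𝒫` of all sequences `(A_n)` of operators on `im P_n` for which the strong
limits `s-lim A_n P_n` and `s-lim A_n^* P_n` exist. (Such sequences are automatically bounded, by
the uniform boundedness principle, see `bounded_of_isStrongLim`.) -/
def FP : StarSubalgebra ℂ BddSeq where
  carrier := {A | (∃ B, IsStrongLim (fun n => A n) B) ∧
    ∃ B, IsStrongLim (fun n => star (A n)) B}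
  mul_mem' := by
    rintro A B ⟨⟨S, hS⟩, ⟨S', hS'⟩⟩ ⟨⟨T, hT⟩, ⟨T', hT'⟩⟩
    refine ⟨⟨S * T, IsStrongLim.mul (lp.norm_apply_le_norm ENNReal.top_ne_zero A) hS hT⟩,
      ⟨T' * S', ?_⟩⟩
    have h := IsStrongLim.mul (fun n => ((norm_star (B n)).le.trans
      (lp.norm_apply_le_norm ENNReal.top_ne_zero B n))) hT' hS'
    simp only [← star_mul] at h
    exact h
  add_mem' := by
    rintro A B ⟨⟨S, hS⟩, ⟨S', hS'⟩⟩ ⟨⟨T, hT⟩, ⟨T', hT'⟩⟩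
    refine ⟨⟨S + T, hS.add hT⟩, ⟨S' + T', ?_⟩⟩
    have h := hS'.add hT'
    simp only [← star_add] at h
    exact h
  algebraMap_mem' := by
    intro c
    refine ⟨⟨c • 1, ?_⟩, ⟨star c • 1, ?_⟩⟩
    · have h := IsStrongLim.smul_one c
      simp only [← Algebra.algebraMap_eq_smul_one] at h
      exact h
    · have h := IsStrongLim.smul_one (star c)
      have h' : ∀ n, star c • (1 : OpIm n) = star (c • (1 : OpIm n)) := fun n => by
        rw [star_smul, star_one]
      simp only [h', ← Algebra.algebraMap_eq_smul_one (A := OpIm _)] at h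
      exact h
  star_mem' := by
    rintro A ⟨⟨S, hS⟩, ⟨S', hS'⟩⟩
    refine ⟨⟨S', hS'⟩, ⟨S, ?_⟩⟩
    simpa only [lp.star_apply, star_star] using hS

instance normedRingFP : NormedRing FP := SubringClass.toNormedRing FP

instance normedStarGroupFP : NormedStarGroup FP := ⟨fun A => (norm_star (A : BddSeq)).le⟩

/-- Sequences with a strong limit are bounded, so that the boundedness which is built into `FP`
is no restriction. -/
theorem bounded_of_isStrongLim {A : ∀ n, OpIm n} {B : OpN} (h : IsStrongLim A B) :
    Memℓp A ∞ := by
  have h1 : ∀ x : ℓ²(ℕ, ℂ), ∃ C, ∀ n, ‖extend n (A n) x‖ ≤ C := fun x => by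
    have h2 := ((h x).norm.comp OrderIso.pnatIsoNat.symm.tendsto_atTop).bddAbove_range
    obtain ⟨C, hC⟩ := h2
    refine ⟨C, fun n => hC ⟨OrderIso.pnatIsoNat n, ?_⟩⟩
    rw [Function.comp_apply, OrderIso.symm_apply_apply]
  obtain ⟨C, hC⟩ := banach_steinhaus h1
  refine memℓp_infty ⟨C, ?_⟩
  rintro _ ⟨n, rfl⟩
  refine ContinuousLinearMap.opNorm_le_bound _ ((norm_nonneg _).trans (hC n)) fun x => ?_
  have h2 := (extend n (A n)).le_of_opNorm_le (hC n) (x : ℓ²(ℕ, ℂ))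
  simpa [extend] using h2

/-- The strong limit `W(𝐀) = s-lim A_n P_n` of a sequence `𝐀 = (A_n) ∈ ℱ^𝒫`. -/
def W (A : FP) : OpN := A.2.1.choose

theorem isStrongLim_W (A : FP) : IsStrongLim (fun n => A.1 n) (W A) := A.2.1.choose_spec

/-- The sequence `(P_n A P_n)` of the finite sections of `A`, as an element of `ℱ^𝒫`. -/
def finSecSeq (A : OpN) : FP :=
  ⟨⟨finSec A, memℓp_infty ⟨‖A‖, by rintro _ ⟨n, rfl⟩; exact norm_finSec_le A n⟩⟩,
    ⟨A, isStrongLim_finSec A⟩, ⟨star A, by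
      have h := isStrongLim_finSec (star A)
      have h' : finSec (star A) = fun n => star (finSec A n) :=
        funext fun n => (star_finSec A n).symm
      rw [h'] at h
      exact h⟩⟩

/-- The smallest closed C⋆-subalgebra of `ℱ^𝒫` which contains all sequences `(P_n A P_n)` of
finite sections of operators `A` in the algebra `opAlg X Y`. -/
def secAlg (X : Set LInf) (Y : Set (ℤ →ᵇ ℂ)) : StarSubalgebra ℂ FP :=
  (StarAlgebra.adjoin ℂ {A : FP | ∃ B ∈ opAlg X Y, A = finSecSeq B}).topologicalClosure

/-- `(λ_1(A_n) + … + λ_n(A_n)) / n`, where `λ_1(A_n), …, λ_n(A_n)` are the eigenvalues of the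
operator `A_n` on the `n`-dimensional space `im P_n`, counted with algebraic multiplicity. -/
def eigMean {n : ℕ+} (A : OpIm n) : ℂ :=
  (A : imP n →ₗ[ℂ] imP n).charpoly.roots.sum / (n : ℕ)

/-! ### The almost periodic part of the main diagonal -/

/-- The main diagonal of an operator on `ℓ²(ℤ⁺)`. -/
def diagN (B : OpN) (n : ℕ) : ℂ := (B (eN n) : ℕ → ℂ) n

/-- `f ∈ AP(ℤ)` and `D(B) - PfP ∈ c_0(ℤ⁺)`. -/
def IsAPPart (B : OpN) (f : ℤ →ᵇ ℂ) : Prop :=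
  f ∈ AP ∧ Tendsto (fun n : ℕ => diagN B n - f n) atTop (𝓝 0)

/-- The almost periodic part `D_ap(B)` of the main diagonal of `B`: the function `f ∈ AP(ℤ)` with
`D(B) - PfP ∈ c_0(ℤ⁺)`. (Meaningful if there is exactly one such function.) -/
def Dap (B : OpN) : ℤ →ᵇ ℂ := Classical.epsilon (IsAPPart B)

end SzegoAP

end

noncomputable section

namespace SzegoAP

/-! ### Almost periodic functions -/

/-! The sum of the eigenvalues of `A_n` is its trace, so only diagonal entries matter
(`eigMean_eq`). The theorem rests on two localization principles, each stable under algebraic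
operations and norm limits.

First, an operator in `opAlg` has columns and rows concentrated near the main diagonal uniformly in
the index, and all its diagonals are asymptotically almost periodic (`isGood_of_mem_opAlg`). Uniform
smallness of the column tails in `ℓ²` replaces approximation by band matrices, which fails for
general `L^∞` symbols. It reduces a diagonal of a product to finite sums, up to a uniform error.

Second, for a sequence in `secAlg`, the columns of `A_n` agree up to `ε` with those of `W(A)`,
except for a number of last columns not depending on `n` (`locConv_of_mem_secAlg`). Those exceptions
change the trace by `O(1)`, hence the mean by `O(1/n)` (`tendsto_diagonal_mean_sub`). What remains
is the Cesàro mean of the diagonal of `W(A)`, which is an almost periodic function plus a null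
sequence. -/

@[simp]
theorem translateFun_apply (f : ℤ →ᵇ ℂ) (k n : ℤ) : translateFun f k n = f (n + k) := rfl

theorem mem_AP_iff {f : ℤ →ᵇ ℂ} :
    f ∈ AP ↔ TotallyBounded (Set.range (translateFun f)) := by
  constructor
  · intro h
    exact (IsCompact.totallyBounded h).subset subset_closure
  · intro h
    exact h.closure.isCompact_of_isClosed isClosed_closure

theorem AP_add {f g : ℤ →ᵇ ℂ} (hf : f ∈ AP) (hg : g ∈ AP) : f + g ∈ AP := by
  refine (IsCompact.add hf hg).closure_of_subset ?_
  rintro _ ⟨k, rfl⟩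
  exact ⟨translateFun f k, subset_closure ⟨k, rfl⟩, translateFun g k, subset_closure ⟨k, rfl⟩, rfl⟩

theorem AP_mul {f g : ℤ →ᵇ ℂ} (hf : f ∈ AP) (hg : g ∈ AP) : f * g ∈ AP := by
  refine (IsCompact.mul hf hg).closure_of_subset ?_
  rintro _ ⟨k, rfl⟩
  exact ⟨translateFun f k, subset_closure ⟨k, rfl⟩, translateFun g k, subset_closure ⟨k, rfl⟩, rfl⟩

theorem AP_star {f : ℤ →ᵇ ℂ} (hf : f ∈ AP) : star f ∈ AP := by
  refine (IsCompact.image hf continuous_star).closure_of_subset ?_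
  rintro _ ⟨k, rfl⟩
  exact ⟨translateFun f k, subset_closure ⟨k, rfl⟩, rfl⟩

theorem AP_const (c : ℂ) : BoundedContinuousFunction.const ℤ c ∈ AP := by
  refine (isCompact_singleton (x := BoundedContinuousFunction.const ℤ c)).closure_of_subset ?_
  rintro _ ⟨k, rfl⟩
  rfl

theorem AP_sub {f g : ℤ →ᵇ ℂ} (hf : f ∈ AP) (hg : g ∈ AP) : f - g ∈ AP := by
  have h := AP_add hf (AP_mul (AP_const (-1)) hg)
  convert h using 1
  ext n
  simp [sub_eq_add_neg]

theorem AP_translate {f : ℤ →ᵇ ℂ} (hf : f ∈ AP) (l : ℤ) : translateFun f l ∈ AP := by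
  refine IsCompact.closure_of_subset hf ?_
  rintro _ ⟨k, rfl⟩
  refine subset_closure ⟨k + l, ?_⟩
  ext n
  simp [add_assoc]

/-- Translation is isometric, so an `ε/2`-net for the translates of `g` is an `ε`-net for those of
`f`. -/
theorem AP_of_approx {f : ℤ →ᵇ ℂ} (h : ∀ ε > 0, ∃ g ∈ AP, dist f g < ε) : f ∈ AP := by
  rw [mem_AP_iff, Metric.totallyBounded_iff]
  intro ε hε
  obtain ⟨g, hg, hfg⟩ := h (ε / 2) (half_pos hε)
  obtain ⟨t, ht, hcov⟩ := Metric.totallyBounded_iff.1 (mem_AP_iff.1 hg) (ε / 2) (half_pos hε)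
  refine ⟨t, ht, ?_⟩
  rintro _ ⟨k, rfl⟩
  obtain ⟨y, hy, hky⟩ := Set.mem_iUnion₂.1 (hcov ⟨k, rfl⟩)
  refine Set.mem_iUnion₂.2 ⟨y, hy, ?_⟩
  rw [Metric.mem_ball] at hky ⊢
  have h1 : dist (translateFun f k) (translateFun g k) ≤ dist f g :=
    (BoundedContinuousFunction.dist_le dist_nonneg).2 fun n =>
      BoundedContinuousFunction.dist_coe_le_dist (n + k)
  linarith [dist_triangle (translateFun f k) (translateFun g k) y]

/-- Almost periodic functions have arbitrarily large approximate periods. -/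
theorem exists_large_period {f : ℤ →ᵇ ℂ} (hf : f ∈ AP) {ε : ℝ} (hε : 0 < ε) (N : ℤ) :
    ∃ τ ≥ N, ∀ n, ‖f (n + τ) - f n‖ ≤ ε := by
  -- Two members of a convergent subsequence of the translates by multiples of `N'` are `ε`-close;
  -- the difference of their shifts is a positive multiple of `N' ≥ N`.
  set N' : ℤ := max N 1
  obtain ⟨y, -, φ, hφ, hlim⟩ := IsCompact.tendsto_subseq hf
    (x := fun j : ℕ => translateFun f (j * N')) fun j => subset_closure ⟨_, rfl⟩
  obtain ⟨K, hK⟩ := Metric.cauchySeq_iff.1 hlim.cauchySeq ε hε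
  have h1 := hK (K + 1) (Nat.le_succ K) K le_rfl
  have h2 : φ K + 1 ≤ φ (K + 1) := hφ (Nat.lt_succ_self K)
  refine ⟨(φ (K + 1) : ℤ) * N' - φ K * N', ?_, fun n => ?_⟩
  · have h3 : (φ K : ℤ) + 1 ≤ φ (K + 1) := by exact_mod_cast h2
    have h4 : 1 ≤ N' := le_max_right _ _
    have h5 : N ≤ N' := le_max_left _ _
    nlinarith
  · have h3 := (BoundedContinuousFunction.dist_coe_le_dist (n - φ K * N')).trans h1.le
    rw [dist_eq_norm] at h3
    simp only [Function.comp_apply, translateFun_apply, sub_add_cancel] at h3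
    rwa [show n - φ K * N' + φ (K + 1) * N' = n + (φ (K + 1) * N' - φ K * N') by ring] at h3

/-- Each value of `f` recurs approximately arbitrarily far to the right. Hence behaviour at `+∞`
controls the supremum norm. -/
theorem AP_norm_le_of_eventually {f : ℤ →ᵇ ℂ} (hf : f ∈ AP) {C : ℝ}
    (h : ∀ᶠ n : ℤ in atTop, ‖f n‖ ≤ C) (n : ℤ) : ‖f n‖ ≤ C := by
  obtain ⟨N, hN⟩ := eventually_atTop.1 h
  refine le_of_forall_pos_le_add fun ε hε => ?_
  obtain ⟨τ, hτ, hper⟩ := exists_large_period hf hε (N - n)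
  have h1 := hN (n + τ) (by linarith)
  have h2 := hper n
  have h3 := norm_sub_norm_le (f n) (f (n + τ))
  rw [norm_sub_rev] at h3
  linarith

/-! ### Mean values of almost periodic functions -/

/-- The mean of `f` over `{x, …, x + n - 1}`. -/
def windowMean (f : ℤ →ᵇ ℂ) (n : ℕ) (x : ℤ) : ℂ := (∑ r ∈ Finset.range n, f (x + r)) / n

theorem norm_windowMean_sub_le {f : ℤ →ᵇ ℂ} {n : ℕ} (hn : 0 < n) {x y : ℤ} {C : ℝ}
    (h : ∀ m, ‖f (m + x) - f (m + y)‖ ≤ C) : ‖windowMean f n x - windowMean f n y‖ ≤ C := by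
  have hn' : (0 : ℝ) < n := by exact_mod_cast hn
  rw [windowMean, windowMean, ← sub_div, ← Finset.sum_sub_distrib, norm_div, Complex.norm_natCast,
    div_le_iff₀ hn']
  refine (norm_sum_le_of_le (Finset.range n) (f := fun r : ℕ => f (x + r) - f (y + r))
    (n := fun _ => C) fun r _ => ?_).trans ?_
  · rw [add_comm x, add_comm y]
    exact h r
  · simp [mul_comm]

/-- Adjacent windows share all but one point each. -/
theorem norm_windowMean_succ_sub_le (f : ℤ →ᵇ ℂ) {n : ℕ} (hn : 0 < n) (x : ℤ) :
    ‖windowMean f n (x + 1) - windowMean f n x‖ ≤ 2 * ‖f‖ / n := by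
  have hn' : (0 : ℝ) < n := by exact_mod_cast hn
  rw [windowMean, windowMean, ← sub_div, norm_div, Complex.norm_natCast]
  gcongr
  have h1 := Finset.sum_range_succ (fun r : ℕ => f (x + r)) n
  rw [Finset.sum_range_succ' (fun r : ℕ => f (x + r)) n] at h1
  have h2 : ∑ r ∈ Finset.range n, f (x + 1 + r) - ∑ r ∈ Finset.range n, f (x + r)
      = f (x + n) - f x := by
    have h3 : ∀ r : ℕ, f (x + 1 + r) = f (x + (r + 1 : ℕ)) := fun r => by
      congr 1; push_cast; ring
    simp only [h3]
    simp only [Nat.cast_zero, add_zero] at h1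
    linear_combination h1
  rw [h2]
  linarith [norm_sub_le (f (x + n)) (f x), f.norm_coe_le_norm (x + n), f.norm_coe_le_norm x]

theorem norm_windowMean_sub_zero_le (f : ℤ →ᵇ ℂ) {n : ℕ} (hn : 0 < n) (x : ℤ) :
    ‖windowMean f n x - windowMean f n 0‖ ≤ |(x : ℝ)| * (2 * ‖f‖ / n) := by
  have hpos : 0 ≤ 2 * ‖f‖ / (n : ℝ) := by positivity
  induction x using Int.induction_on with
  | zero => simp
  | succ i ih =>
    have h1 := norm_windowMean_succ_sub_le f hn i
    have h2 := norm_sub_le_norm_sub_add_norm_sub (windowMean f n (i + 1)) (windowMean f n i)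
      (windowMean f n 0)
    push_cast at *
    rw [abs_of_nonneg (by positivity)] at ih ⊢
    linarith
  | pred i ih =>
    have h1 := norm_windowMean_succ_sub_le f hn (-i - 1)
    rw [sub_add_cancel, norm_sub_rev] at h1
    have h2 := norm_sub_le_norm_sub_add_norm_sub (windowMean f n (-i - 1)) (windowMean f n (-i))
      (windowMean f n 0)
    push_cast at *
    rw [abs_of_nonpos (by linarith [(Nat.cast_nonneg i : (0 : ℝ) ≤ i)])] at ih ⊢
    linarith

/-- The window means of an almost periodic function are asymptotically independent of the position
of the window. -/
theorem windowMean_uniform {f : ℤ →ᵇ ℂ} (hf : f ∈ AP) {ε : ℝ} (hε : 0 < ε) :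
    ∃ N : ℕ, 0 < N ∧ ∀ n ≥ N, ∀ x, ‖windowMean f n x - windowMean f n 0‖ ≤ ε := by
  -- The finite net is chosen among the translates themselves, so every window can be replaced by
  -- one of finitely many, with start at distance at most `K` from `0`.
  obtain ⟨t, hts, htf, hcov⟩ :=
    (mem_AP_iff.1 hf).exists_subset (Metric.dist_mem_uniformity (half_pos hε))
  choose! k hk using fun y (hy : y ∈ t) => hts hy
  obtain ⟨K, hK⟩ := (htf.image fun y => |(k y : ℝ)|).bddAbove
  obtain ⟨N, hN⟩ := exists_nat_gt (max 0 (|K| * (2 * ‖f‖) / (ε / 2)))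
  have hN0 : 0 < N := by exact_mod_cast (le_max_left _ _).trans_lt hN
  refine ⟨N, hN0, fun n hn x => ?_⟩
  have hn0 : 0 < n := hN0.trans_le hn
  have hn' : (0 : ℝ) < n := by exact_mod_cast hn0
  obtain ⟨y, hy, hxy⟩ := Set.mem_iUnion₂.1 (hcov ⟨x, rfl⟩)
  have hxy' : dist (translateFun f x) (translateFun f (k y)) < ε / 2 := by
    rw [hk y hy]; exact hxy
  have h1 : ‖windowMean f n x - windowMean f n (k y)‖ ≤ ε / 2 :=
    norm_windowMean_sub_le hn0 fun m =>
      (dist_eq_norm (f (m + x)) (f (m + k y))).symm.le.trans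
        ((BoundedContinuousFunction.dist_coe_le_dist m).trans hxy'.le)
  have h2 := norm_windowMean_sub_zero_le f hn0 (k y)
  have h3 : |(k y : ℝ)| * (2 * ‖f‖ / n) ≤ ε / 2 := by
    have h4 : |(k y : ℝ)| ≤ |K| := (hK ⟨y, hy, rfl⟩).trans (le_abs_self K)
    have h5 : |K| * (2 * ‖f‖) / (ε / 2) < n :=
      ((le_max_right _ _).trans_lt hN).trans_le (by exact_mod_cast hn)
    rw [div_lt_iff₀ (half_pos hε)] at h5
    rw [← mul_div_assoc, div_le_iff₀ hn']
    nlinarith [mul_le_mul_of_nonneg_right h4 (by positivity : 0 ≤ 2 * ‖f‖)]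
  linarith [norm_sub_le_norm_sub_add_norm_sub (windowMean f n x) (windowMean f n (k y))
    (windowMean f n 0)]

theorem windowMean_mul (f : ℤ →ᵇ ℂ) {m n : ℕ} (hm : 0 < m) (hn : 0 < n) :
    windowMean f (m * n) 0 = (∑ j ∈ Finset.range m, windowMean f n (j * n)) / m := by
  have hm' : (m : ℂ) ≠ 0 := by exact_mod_cast hm.ne'
  have hn' : (n : ℂ) ≠ 0 := by exact_mod_cast hn.ne'
  have h : ∀ m : ℕ, ∑ r ∈ Finset.range (m * n), f (0 + r)
      = ∑ j ∈ Finset.range m, ∑ r ∈ Finset.range n, f (j * n + r) := by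
    intro m
    induction m with
    | zero => simp
    | succ m ih =>
      rw [Nat.succ_mul, Finset.sum_range_add, ih, Finset.sum_range_succ]
      simp
  simp only [windowMean, ← Finset.sum_div]
  rw [h, div_div, mul_comm (n : ℂ), Nat.cast_mul]

/-- The mean over `m * n` points averages `m` window means of length `n`, all close to the one at
`0`. By symmetry it is also close to the mean over `m` points, so it links the two. -/
theorem cauchySeq_windowMean {f : ℤ →ᵇ ℂ} (hf : f ∈ AP) :
    CauchySeq fun n : ℕ => windowMean f n 0 := by
  rw [Metric.cauchySeq_iff]
  intro ε hε
  obtain ⟨N, hN, h⟩ := windowMean_uniform hf (ε := ε / 3) (by positivity)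
  have key : ∀ m ≥ N, ∀ n ≥ N, ‖windowMean f (m * n) 0 - windowMean f n 0‖ ≤ ε / 3 := by
    intro m hm n hn
    have hm0 := hN.trans_le hm
    have hm' : (0 : ℝ) < m := by exact_mod_cast hm0
    have hmc : (m : ℂ) ≠ 0 := by exact_mod_cast hm0.ne'
    have h1 : windowMean f (m * n) 0 - windowMean f n 0
        = (∑ j ∈ Finset.range m, (windowMean f n (j * n) - windowMean f n 0)) / m := by
      rw [windowMean_mul f hm0 (hN.trans_le hn), Finset.sum_sub_distrib, sub_div]
      simp [hmc]
    rw [h1, norm_div, Complex.norm_natCast, div_le_iff₀ hm']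
    refine (norm_sum_le_of_le (Finset.range m) fun (j : ℕ) _ => h n hn (j * n)).trans ?_
    simp [mul_comm]
  refine ⟨N, fun m hm n hn => ?_⟩
  have h1 := key m hm n hn
  have h2 := key n hn m hm
  rw [mul_comm n m, norm_sub_rev] at h2
  rw [dist_eq_norm]
  linarith [norm_sub_le_norm_sub_add_norm_sub (windowMean f m 0) (windowMean f (m * n) 0)
    (windowMean f n 0)]

/-- Almost periodic functions have a mean value. -/
theorem tendsto_arithMean {f : ℤ →ᵇ ℂ} (hf : f ∈ AP) :
    Tendsto (arithMean f) atTop (𝓝 (meanValue f)) := by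
  obtain ⟨c, hc⟩ := cauchySeq_tendsto_of_complete (cauchySeq_windowMean hf)
  refine tendsto_nhds_limUnder ⟨c, ?_⟩
  refine (hc.comp tendsto_PNat_val_atTop_atTop).congr fun n => ?_
  simp [windowMean, arithMean]

/-! ### Asymptotically almost periodic functions -/

/-- Functions on `ℤ` which are asymptotically almost periodic at `+∞`. -/
def AAP (g : ℤ → ℂ) : Prop := ∃ f ∈ AP, Tendsto (fun n => g n - f n) atTop (𝓝 0)

theorem AAP.add {g h : ℤ → ℂ} (hg : AAP g) (hh : AAP h) : AAP fun n => g n + h n := by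
  obtain ⟨f, hf, hf'⟩ := hg
  obtain ⟨k, hk, hk'⟩ := hh
  refine ⟨f + k, AP_add hf hk, ?_⟩
  have := hf'.add hk'
  rw [add_zero] at this
  refine this.congr fun n => ?_
  simp only [BoundedContinuousFunction.coe_add, Pi.add_apply]
  ring

theorem AAP.star {g : ℤ → ℂ} (hg : AAP g) : AAP fun n => star (g n) := by
  obtain ⟨f, hf, hf'⟩ := hg
  refine ⟨_, AP_star hf, ?_⟩
  have := hf'.star
  rw [star_zero] at this
  exact this.congr fun n => by simp

theorem AAP.translate {g : ℤ → ℂ} (hg : AAP g) (l : ℤ) : AAP fun n => g (n + l) := by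
  obtain ⟨f, hf, hf'⟩ := hg
  exact ⟨_, AP_translate hf l, hf'.comp (tendsto_atTop_add_const_right _ l tendsto_id)⟩

theorem AAP.of_mem_AP {f : ℤ →ᵇ ℂ} (hf : f ∈ AP) : AAP f := ⟨f, hf, by simp⟩

theorem AAP.congr' {g h : ℤ → ℂ} (hg : AAP g) (hgh : g =ᶠ[atTop] h) : AAP h := by
  obtain ⟨f, hf, hf'⟩ := hg
  exact ⟨f, hf, hf'.congr' (hgh.mono fun n hn => by rw [hn])⟩

theorem AAP.const (c : ℂ) : AAP fun _ => c := AAP.of_mem_AP (AP_const c)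

theorem AAP.mul {g h : ℤ → ℂ} (hg : AAP g) (hh : AAP h) : AAP fun n => g n * h n := by
  obtain ⟨f, hf, hf'⟩ := hg
  obtain ⟨k, hk, hk'⟩ := hh
  refine ⟨f * k, AP_mul hf hk, ?_⟩
  have bdd : ∀ f : ℤ →ᵇ ℂ, IsBoundedUnder (· ≤ ·) atTop (norm ∘ f) := fun f =>
    isBoundedUnder_of ⟨‖f‖, fun n => f.norm_coe_le_norm n⟩
  have h1 := (hf'.mul hk').add ((hf'.zero_mul_isBoundedUnder_le (bdd k)).add
    (hk'.zero_mul_isBoundedUnder_le (bdd f)))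
  simp only [add_zero, mul_zero] at h1
  refine h1.congr fun n => ?_
  simp only [BoundedContinuousFunction.coe_mul, Pi.mul_apply]
  ring

theorem AAP.sum {ι : Type*} (s : Finset ι) {g : ι → ℤ → ℂ} (hg : ∀ i ∈ s, AAP (g i)) :
    AAP fun n => ∑ i ∈ s, g i n := by
  classical
  induction s using Finset.induction_on with
  | empty => simpa using AAP.const 0
  | insert i s hi ih =>
    simp only [Finset.sum_insert hi]
    exact (hg i (Finset.mem_insert_self i s)).add
      (ih fun j hj => hg j (Finset.mem_insert_of_mem hj))

/-- The almost periodic approximants are compared only near `+∞`, but `AP_norm_le_of_eventually`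
upgrades this to the supremum norm. They are therefore Cauchy, and their limit is the almost
periodic part. -/
theorem AAP.of_approx {g : ℤ → ℂ}
    (h : ∀ ε > 0, ∃ k, AAP k ∧ ∀ᶠ n in atTop, ‖g n - k n‖ ≤ ε) : AAP g := by
  have h1 : ∀ ε > 0, ∃ f ∈ AP, ∀ᶠ n in atTop, ‖g n - f n‖ ≤ ε := by
    intro ε hε
    obtain ⟨k, ⟨f, hf, hf'⟩, hgk⟩ := h (ε / 2) (half_pos hε)
    refine ⟨f, hf, ?_⟩
    filter_upwards [hgk, (Metric.tendsto_nhds.1 hf') (ε / 2) (half_pos hε)] with n hn hn'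
    rw [dist_zero_right] at hn'
    linarith [norm_sub_le_norm_sub_add_norm_sub (g n) (k n) (f n)]
  have hpos : ∀ j : ℕ, 0 < 1 / ((j : ℝ) + 1) := fun j => Nat.one_div_pos_of_nat
  choose f hf hgf using fun j : ℕ => h1 (1 / ((j : ℝ) + 1)) (hpos j)
  have hdist : ∀ i j, dist (f i) (f j) ≤ 1 / ((i : ℝ) + 1) + 1 / ((j : ℝ) + 1) := by
    intro i j
    rw [dist_eq_norm]
    refine (BoundedContinuousFunction.norm_le (add_pos (hpos i) (hpos j)).le).2 fun n => ?_
    refine AP_norm_le_of_eventually (AP_sub (hf i) (hf j)) ?_ n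
    filter_upwards [hgf i, hgf j] with n hi hj
    have := norm_sub_le_norm_sub_add_norm_sub (f i n) (g n) (f j n)
    rw [norm_sub_rev] at hi
    simp only [BoundedContinuousFunction.coe_sub, Pi.sub_apply]
    linarith
  have hlim0 := tendsto_one_div_add_atTop_nhds_zero_nat (𝕜 := ℝ)
  have hC : CauchySeq f := by
    refine cauchySeq_of_le_tendsto_0 (fun N : ℕ => 2 * (1 / ((N : ℝ) + 1))) ?_ ?_
    · intro i j N hi hj
      have e1 := Nat.one_div_le_one_div (α := ℝ) hi
      have e2 := Nat.one_div_le_one_div (α := ℝ) hj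
      linarith [hdist i j]
    · simpa using hlim0.const_mul 2
  obtain ⟨F, hF⟩ := cauchySeq_tendsto_of_complete hC
  refine ⟨F, AP_of_approx fun ε hε => ?_, Metric.tendsto_nhds.2 fun ε hε => ?_⟩
  · obtain ⟨j, hj⟩ := ((Metric.tendsto_nhds.1 hF) ε hε).exists
    exact ⟨f j, hf j, by rwa [dist_comm]⟩
  · obtain ⟨j, hj, hj'⟩ := (((Metric.tendsto_nhds.1 hF) (ε / 2) (half_pos hε)).and
      ((Metric.tendsto_nhds.1 hlim0) (ε / 2) (half_pos hε))).exists
    filter_upwards [hgf j] with n hn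
    rw [dist_zero_right, Real.norm_of_nonneg (hpos j).le] at hj'
    have e1 : ‖f j n - F n‖ ≤ dist (f j) F := by
      rw [← dist_eq_norm]; exact BoundedContinuousFunction.dist_coe_le_dist n
    rw [dist_zero_right]
    linarith [norm_sub_le_norm_sub_add_norm_sub (g n) (f j n) (F n)]

/-! ### Coordinates and truncations in `ℓ²` -/

/-- Used with the identity and with shifts `k ↦ k - i`, which carry a column over `ℕ` to a vector
over `ℤ`. -/
theorem norm_le_of_injective {α β : Type*} {x : ℓ²(α, ℂ)} {z : ℓ²(β, ℂ)} {φ : α → β}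
    (hφ : Function.Injective φ) (h : ∀ k, ‖x k‖ ≤ ‖z (φ k)‖) : ‖x‖ ≤ ‖z‖ := by
  have hp : 0 < (2 : ℝ≥0∞).toReal := by norm_num
  have hz := (lp.memℓp z).summable hp
  have hx := (lp.memℓp x).summable hp
  refine lp.norm_le_of_tsum_le hp (norm_nonneg z) ?_
  rw [lp.norm_rpow_eq_tsum hp z]
  exact hx.tsum_le_tsum_of_inj φ hφ (fun c _ => by positivity)
    (fun n => Real.rpow_le_rpow (norm_nonneg _) (h n) hp.le) hz

/-- The restriction of `x` to the finite set `s`. -/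
def trunc {α : Type*} [DecidableEq α] (s : Finset α) (x : ℓ²(α, ℂ)) : ℓ²(α, ℂ) :=
  ∑ j ∈ s, lp.single 2 j (x j)

theorem trunc_apply {α : Type*} [DecidableEq α] (s : Finset α) (x : ℓ²(α, ℂ)) (k : α) :
    trunc s x k = if k ∈ s then x k else 0 := by
  rw [trunc, lp.coeFn_sum, Finset.sum_apply]
  simp [lp.single_apply, Pi.single_apply]

theorem sub_trunc_apply {α : Type*} [DecidableEq α] (s : Finset α) (x : ℓ²(α, ℂ)) (k : α) :
    (x - trunc s x) k = if k ∈ s then 0 else x k := by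
  rw [lp.coeFn_sub, Pi.sub_apply, trunc_apply]
  split_ifs <;> simp

/-- The truncation is the best approximation by vectors supported in `s`. -/
theorem norm_sub_trunc_le {α : Type*} [DecidableEq α] {s : Finset α} (x : ℓ²(α, ℂ))
    {w : ℓ²(α, ℂ)} (hw : ∀ k ∉ s, w k = 0) : ‖x - trunc s x‖ ≤ ‖x - w‖ := by
  refine norm_le_of_injective Function.injective_id fun k => ?_
  rw [sub_trunc_apply]
  split_ifs with h
  · simp
  · simp [hw k h]

theorem tendsto_norm_sub_trunc {α : Type*} [DecidableEq α] (x : ℓ²(α, ℂ)) :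
    Tendsto (fun s => ‖x - trunc s x‖) atTop (𝓝 0) := by
  have h := lp.hasSum_single (p := 2) (by norm_num) x
  have h2 := tendsto_iff_norm_sub_tendsto_zero.1 h
  exact h2.congr fun s => norm_sub_rev _ _

theorem eN_apply (i k : ℕ) : eN i k = if k = i then 1 else 0 := by
  simp [eN, lp.single_apply, Pi.single_apply]

theorem norm_eN (i : ℕ) : ‖eN i‖ = 1 := by
  simp [eN, lp.norm_single]

theorem trunc_eq_sum_eN (s : Finset ℕ) (x : ℓ²(ℕ, ℂ)) : trunc s x = ∑ j ∈ s, x j • eN j := by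
  refine Finset.sum_congr rfl fun j _ => ?_
  rw [eN, ← lp.single_smul]
  simp

theorem norm_apply_le (x : ℓ²(ℕ, ℂ)) (i : ℕ) : ‖x i‖ ≤ ‖x‖ :=
  lp.norm_apply_le_norm (by norm_num) x i

theorem norm_column_le (B : OpN) (i : ℕ) : ‖B (eN i)‖ ≤ ‖B‖ := by
  simpa [norm_eN] using B.le_opNorm (eN i)

theorem norm_entry_le (B : OpN) (i j : ℕ) : ‖B (eN j) i‖ ≤ ‖B‖ :=
  (norm_apply_le _ _).trans (norm_column_le B j)

theorem adjoint_restr_eN (j : ℕ) : restr.adjoint (eN j) = eZ j := by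
  refine ext_inner_right ℂ fun x => ?_
  rw [ContinuousLinearMap.adjoint_inner_left, eN, eZ, lp.inner_single_left, lp.inner_single_left]
  rfl

theorem compress_entry (M : OpZ) (i j : ℕ) : compress M (eN j) i = M (eZ j) (i : ℤ) := by
  rw [compress, ContinuousLinearMap.comp_apply, ContinuousLinearMap.comp_apply, adjoint_restr_eN]
  rfl

theorem star_entry (B : OpN) (i j : ℕ) : (star B) (eN j) i = star (B (eN i) j) := by
  have h1 : inner ℂ (eN i) ((star B) (eN j)) = inner ℂ (B (eN i)) (eN j) := by
    rw [ContinuousLinearMap.star_eq_adjoint, ContinuousLinearMap.adjoint_inner_right]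
  rw [eN, lp.inner_single_left, ← eN, eN, eN, lp.inner_single_right] at h1
  simpa [eN] using h1

/-! ### Operators with localized columns -/

/-- The columns of `B` are concentrated near the main diagonal, uniformly. -/
def ColLoc (B : OpN) : Prop :=
  ∀ ε > 0, ∃ m : ℕ, ∀ i : ℕ,
    -- The subtraction `i - m` is truncated, so windows near the upper left corner simply start at
    -- `0`.
    ‖B (eN i) - trunc (Finset.Icc (i - m) (i + m)) (B (eN i))‖ ≤ ε

/-- Every column lies below a shift of the same `ℓ²` vector, whose tail is small independently of
the shift. -/
theorem ColLoc.of_dominated {B : OpN} (u : ℓ²(ℤ, ℂ))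
    (h : ∀ i k : ℕ, ‖B (eN i) k‖ ≤ ‖u ((k : ℤ) - i)‖) : ColLoc B := by
  intro ε hε
  obtain ⟨s, hs⟩ := ((tendsto_norm_sub_trunc u).eventually_le_const hε).exists
  refine ⟨s.sup Int.natAbs, fun i => le_trans ?_ hs⟩
  refine norm_le_of_injective (φ := fun k : ℕ => (k : ℤ) - i) (fun a b hab => by simpa using hab)
    fun k => ?_
  rw [sub_trunc_apply, sub_trunc_apply]
  split_ifs with h1 h2 h2
  · simp
  · simp
  · exfalso
    have h3 : ((k : ℤ) - i).natAbs ≤ s.sup Int.natAbs := Finset.le_sup h2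
    apply h1
    rw [Finset.mem_Icc]
    omega
  · exact h i k

theorem ColLoc.star_of_dominated {B : OpN} (u : ℓ²(ℤ, ℂ))
    (h : ∀ i k : ℕ, ‖B (eN i) k‖ ≤ ‖u ((k : ℤ) - i)‖) : ColLoc (star B) := by
  refine ColLoc.of_dominated
    ⟨fun k => u (-k), memℓp_gen (((lp.memℓp u).summable (by norm_num)).comp_injective neg_injective)⟩
    fun i k => ?_
  rw [star_entry, norm_star]
  refine (h k i).trans (le_of_eq ?_)
  change _ = ‖u (-((k : ℤ) - i))‖
  rw [neg_sub]

theorem ColLoc.of_approx {B : OpN} (h : ∀ ε > 0, ∃ C, ColLoc C ∧ ‖B - C‖ ≤ ε) : ColLoc B := by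
  intro ε hε
  obtain ⟨C, hC, hBC⟩ := h (ε / 2) (half_pos hε)
  obtain ⟨m, hm⟩ := hC (ε / 2) (half_pos hε)
  refine ⟨m, fun i => ?_⟩
  refine (norm_sub_trunc_le (w := trunc (Finset.Icc (i - m) (i + m)) (C (eN i))) _
    fun k hk => ?_).trans ?_
  · rw [trunc_apply, if_neg hk]
  · have h1 := norm_column_le (B - C) i
    rw [sub_apply] at h1
    linarith [norm_sub_le_norm_sub_add_norm_sub (B (eN i)) (C (eN i))
      (trunc (Finset.Icc (i - m) (i + m)) (C (eN i))), hm i]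

theorem ColLoc.add {A B : OpN} (hA : ColLoc A) (hB : ColLoc B) : ColLoc (A + B) := by
  intro ε hε
  obtain ⟨m, hm⟩ := hA (ε / 2) (half_pos hε)
  obtain ⟨m', hm'⟩ := hB (ε / 2) (half_pos hε)
  refine ⟨max m m', fun i => ?_⟩
  refine (norm_sub_trunc_le (w := trunc (Finset.Icc (i - m) (i + m)) (A (eN i))
    + trunc (Finset.Icc (i - m') (i + m')) (B (eN i))) _ fun k hk => ?_).trans ?_
  · rw [Finset.mem_Icc] at hk
    rw [lp.coeFn_add, Pi.add_apply, trunc_apply, trunc_apply, if_neg, if_neg, add_zero]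
    all_goals rw [Finset.mem_Icc]; omega
  · rw [add_apply, add_sub_add_comm]
    linarith [norm_add_le (A (eN i) - trunc (Finset.Icc (i - m) (i + m)) (A (eN i)))
      (B (eN i) - trunc (Finset.Icc (i - m') (i + m')) (B (eN i))), hm i, hm' i]

theorem card_window_le (i m : ℕ) : ((Finset.Icc (i - m) (i + m)).card : ℝ) ≤ 2 * m + 1 := by
  rw [Nat.card_Icc]
  have : i + m + 1 - (i - m) ≤ 2 * m + 1 := by omega
  exact_mod_cast this

/-- Up to a small error `A (B (eN i))` combines the at most `2m + 1` columns of `A` in a window of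
`B`. Each is localized, so the windows add up to radius `m + m'`; the tolerance defining `m'`
depends on `m`. -/
theorem ColLoc.mul {A B : OpN} (hA : ColLoc A) (hB : ColLoc B) : ColLoc (A * B) := by
  intro ε hε
  obtain ⟨m, hm⟩ := hB (ε / (2 * (‖A‖ + 1))) (by positivity)
  obtain ⟨m', hm'⟩ := hA (ε / (2 * ((2 * m + 1) * (‖B‖ + 1)))) (by positivity)
  refine ⟨m + m', fun i => ?_⟩
  set s := Finset.Icc (i - m) (i + m)
  set w : ℓ²(ℕ, ℂ) := ∑ j ∈ s, (B (eN i) j) • trunc (Finset.Icc (j - m') (j + m')) (A (eN j))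
  refine (norm_sub_trunc_le (w := w) _ fun k hk => ?_).trans ?_
  · rw [Finset.mem_Icc] at hk
    rw [lp.coeFn_sum, Finset.sum_apply]
    refine Finset.sum_eq_zero fun j hj => ?_
    rw [Finset.mem_Icc] at hj
    rw [lp.coeFn_smul, Pi.smul_apply, trunc_apply, if_neg, smul_zero]
    rw [Finset.mem_Icc]
    omega
  · have h1 : (A * B) (eN i) - w = A (B (eN i) - trunc s (B (eN i)))
        + ∑ j ∈ s, (B (eN i) j) • (A (eN j) - trunc (Finset.Icc (j - m') (j + m')) (A (eN j))) := by
      rw [map_sub, trunc_eq_sum_eN, map_sum]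
      simp only [map_smul, smul_sub, Finset.sum_sub_distrib, w]
      rw [sub_add_sub_cancel]
      rfl
    rw [h1]
    have h2 : ‖A (B (eN i) - trunc s (B (eN i)))‖ ≤ ε / 2 := by
      refine (A.le_opNorm _).trans ?_
      refine (mul_le_mul_of_nonneg_left (hm i) (norm_nonneg A)).trans ?_
      rw [← mul_div_assoc, div_le_iff₀ (by positivity)]
      nlinarith [norm_nonneg A]
    have h3 : ‖∑ j ∈ s, (B (eN i) j) •
        (A (eN j) - trunc (Finset.Icc (j - m') (j + m')) (A (eN j)))‖ ≤ ε / 2 := by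
      refine (norm_sum_le_of_le (n := fun _ => ‖B‖ * (ε / (2 * ((2 * m + 1) * (‖B‖ + 1))))) _
        fun j _ => ?_).trans ?_
      · rw [norm_smul]
        gcongr
        · exact norm_entry_le B j i
        · exact hm' j
      · rw [Finset.sum_const, nsmul_eq_mul]
        refine (mul_le_mul_of_nonneg_right (card_window_le i m) (by positivity)).trans ?_
        rw [← mul_div_assoc, ← mul_div_assoc, div_le_iff₀ (by positivity)]
        have : 0 ≤ (2 * (m : ℝ) + 1) * ε := by positivity
        nlinarith
    exact (norm_add_le _ _).trans (by linarith)

/-! ### Operators with asymptotically almost periodic diagonals -/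

/-- The entries of `B`, indexed by integers (with irrelevant values at negative indices). -/
def entZ (B : OpN) (i j : ℤ) : ℂ := B (eN j.toNat) i.toNat

/-- All diagonals of `B` are asymptotically almost periodic. -/
def AllDiag (B : OpN) : Prop := ∀ l : ℤ, AAP fun n => entZ B (n + l) n

theorem AllDiag.entry {B : OpN} (h : AllDiag B) (l d : ℤ) :
    AAP fun n => entZ B (n + l) (n + d) := by
  have h1 := (h (l - d)).translate d
  exact h1.congr' (Eventually.of_forall fun n => by simp only; congr 1; ring)

theorem AllDiag.add {A B : OpN} (hA : AllDiag A) (hB : AllDiag B) : AllDiag (A + B) :=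
  fun l => (hA l).add (hB l)

theorem AllDiag.star {B : OpN} (hB : AllDiag B) : AllDiag (star B) := by
  intro l
  have h := (hB.entry 0 l).star
  refine h.congr' (Eventually.of_forall fun n => ?_)
  simp only [entZ]
  rw [star_entry, add_zero]

theorem AllDiag.of_approx {B : OpN} (h : ∀ ε > 0, ∃ C, AllDiag C ∧ ‖B - C‖ ≤ ε) :
    AllDiag B := by
  intro l
  refine AAP.of_approx fun ε hε => ?_
  obtain ⟨C, hC, hBC⟩ := h ε hε
  exact ⟨_, hC l, Eventually.of_forall fun n => (norm_entry_le (B - C) _ _).trans hBC⟩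

/-- Localization of the columns of `B` cuts the matrix product to offsets `|d| ≤ m` uniformly in
`n`, leaving a finite sum of products of diagonals. -/
theorem AllDiag.mul {A B : OpN} (hA : AllDiag A) (hB : AllDiag B) (hloc : ColLoc B) :
    AllDiag (A * B) := by
  intro l
  refine AAP.of_approx fun ε hε => ?_
  obtain ⟨m, hm⟩ := hloc (ε / (‖A‖ + 1)) (by positivity)
  refine ⟨fun n => ∑ d ∈ Finset.Icc (-m : ℤ) m, entZ B (n + d) n * entZ A (n + l) (n + d),
    AAP.sum _ fun d _ => (hB d).mul (hA.entry l d), ?_⟩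
  -- From `n ≥ m` on, all `n + d` are nonnegative, so `toNat` loses nothing and `d ↦ n + d` is a
  -- bijection onto the window.
  filter_upwards [eventually_ge_atTop (m : ℤ)] with n hn
  lift n to ℕ using by omega
  have hmn : m ≤ n := by omega
  have h1 : ∑ d ∈ Finset.Icc (-m : ℤ) m, entZ B (n + d) n * entZ A (n + l) (n + d)
      = A (trunc (Finset.Icc (n - m) (n + m)) (B (eN n))) (n + l).toNat := by
    rw [trunc_eq_sum_eN, map_sum, lp.coeFn_sum, Finset.sum_apply]
    refine Finset.sum_bij' (fun d _ => (n + d).toNat) (fun j _ => (j : ℤ) - n) ?_ ?_ ?_ ?_ ?_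
    · intro d hd
      rw [Finset.mem_Icc] at *
      omega
    · intro j hj
      rw [Finset.mem_Icc] at *
      omega
    · intro d hd
      rw [Finset.mem_Icc] at hd
      omega
    · intro j hj
      omega
    · intro d hd
      simp [entZ]
  rw [h1]
  have h2 : entZ (A * B) (n + l) n - A (trunc (Finset.Icc (n - m) (n + m)) (B (eN n))) (n + l).toNat
      = A (B (eN n) - trunc (Finset.Icc (n - m) (n + m)) (B (eN n))) (n + l).toNat := by
    rw [map_sub]
    rfl
  rw [h2]
  refine (norm_apply_le _ _).trans ((A.le_opNorm _).trans ?_)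
  refine (mul_le_mul_of_nonneg_left (hm n) (norm_nonneg A)).trans ?_
  rw [← mul_div_assoc, div_le_iff₀ (by positivity)]
  nlinarith [norm_nonneg A]

/-! ### The algebra `opAlg` -/

/-- Both the columns and the rows of `B` are localized, and its diagonals are asymptotically almost
periodic. -/
def IsGood (B : OpN) : Prop := ColLoc B ∧ ColLoc (star B) ∧ AllDiag B

theorem IsGood.star {B : OpN} (h : IsGood B) : IsGood (star B) :=
  ⟨h.2.1, by rw [star_star]; exact h.1, h.2.2.star⟩

theorem IsGood.add {A B : OpN} (hA : IsGood A) (hB : IsGood B) : IsGood (A + B) :=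
  ⟨hA.1.add hB.1, by rw [star_add]; exact hA.2.1.add hB.2.1, hA.2.2.add hB.2.2⟩

theorem IsGood.mul {A B : OpN} (hA : IsGood A) (hB : IsGood B) : IsGood (A * B) :=
  ⟨hA.1.mul hB.1, by rw [star_mul]; exact hB.2.1.mul hA.2.1, hA.2.2.mul hB.2.2 hB.1⟩

/-- Columns are cut-off shifts of the single vector `L(a) e_0`, the Fourier coefficients of `a`.
Being in `ℓ²` suffices; no absolute summability is needed. -/
theorem isGood_toeplitz (a : LInf) : IsGood (toeplitz a) := by
  have h : ∀ i k : ℕ, toeplitz a (eN i) k = laurent a (eZ 0) ((k : ℤ) - i) := by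
    intro i k
    rw [toeplitz, compress_entry, laurent_entry, laurent_entry, sub_zero]
  refine ⟨ColLoc.of_dominated (laurent a (eZ 0)) fun i k => (congrArg norm (h i k)).le,
    ColLoc.star_of_dominated (laurent a (eZ 0)) fun i k => (congrArg norm (h i k)).le,
    fun l => (AAP.const (laurent a (eZ 0) l)).congr' ?_⟩
  filter_upwards [eventually_ge_atTop 0, eventually_ge_atTop (-l)] with n hn hn'
  rw [entZ, h, show (((n + l).toNat : ℤ) - n.toNat) = l by omega]

theorem mulOp_entry (b : ℤ →ᵇ ℂ) (i j : ℕ) :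
    compress (mulOp b) (eN j) i = if i = j then b i else 0 := by
  rw [compress_entry]
  change b i * eZ j i = _
  simp [eZ, lp.single_apply, Pi.single_apply]

/-- Covers multiplication operators and scalars alike; a multiple of the unit vector at `0`
dominates all columns. -/
theorem isGood_of_diagonal {B : OpN} {b : ℤ →ᵇ ℂ} (hb : b ∈ AP)
    (hB : ∀ i j : ℕ, B (eN j) i = if i = j then b i else 0) : IsGood B := by
  have h : ∀ i k : ℕ, ‖B (eN i) k‖
      ≤ ‖(lp.single 2 0 (‖b‖ : ℂ) : ℓ²(ℤ, ℂ)) ((k : ℤ) - i)‖ := by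
    intro i k
    rw [hB]
    split_ifs with hik
    · subst hik
      simpa using b.norm_coe_le_norm k
    · simp
  refine ⟨ColLoc.of_dominated _ h, ColLoc.star_of_dominated _ h, fun l => ?_⟩
  by_cases hl : l = 0
  · refine (AAP.of_mem_AP hb).congr' ?_
    filter_upwards [eventually_ge_atTop 0] with n hn
    rw [entZ, hB, hl, add_zero, if_pos rfl, Int.toNat_of_nonneg hn]
  · refine (AAP.const 0).congr' ?_
    filter_upwards [eventually_ge_atTop 0, eventually_ge_atTop (-l)] with n hn hn'
    rw [entZ, hB, if_neg]
    omega

theorem isGood_mulOp {b : ℤ →ᵇ ℂ} (hb : b ∈ AP) : IsGood (compress (mulOp b)) :=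
  isGood_of_diagonal hb (mulOp_entry b)

theorem isGood_algebraMap (c : ℂ) : IsGood (algebraMap ℂ OpN c) := by
  refine isGood_of_diagonal (AP_const c) fun i j => ?_
  rw [Algebra.algebraMap_eq_smul_one]
  change c * eN j i = _
  simp [eN_apply]

theorem isGood_of_mem_opAlg {B : OpN} (hB : B ∈ opAlg Set.univ AP) : IsGood B := by
  have h : ∀ C ∈ StarAlgebra.adjoin ℂ ({A : OpN | ∃ a ∈ (Set.univ : Set LInf), A = toeplitz a} ∪
      {A | ∃ b ∈ AP, A = compress (mulOp b)}), IsGood C := by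
    intro C hC
    induction hC using StarAlgebra.adjoin_induction with
    | mem x hx =>
      obtain ⟨a, -, rfl⟩ | ⟨b, hb, rfl⟩ := hx
      · exact isGood_toeplitz a
      · exact isGood_mulOp hb
    | algebraMap c => exact isGood_algebraMap c
    | add x y _ _ hx hy => exact hx.add hy
    | mul x y _ _ hx hy => exact hx.mul hy
    | star x _ hx => exact hx.star
  have h1 : ∀ ε > 0, ∃ C, IsGood C ∧ ‖B - C‖ ≤ ε := by
    intro ε hε
    obtain ⟨C, hC, hBC⟩ := Metric.mem_closure_iff.1 hB ε hε
    exact ⟨C, h C hC, by rw [← dist_eq_norm]; exact hBC.le⟩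
  refine ⟨ColLoc.of_approx fun ε hε => ?_, ColLoc.of_approx fun ε hε => ?_,
    AllDiag.of_approx fun ε hε => ?_⟩
  all_goals obtain ⟨C, hC, hBC⟩ := h1 ε hε
  · exact ⟨C, hC.1, hBC⟩
  · exact ⟨_, hC.2.1, by rw [← star_sub, norm_star]; exact hBC⟩
  · exact ⟨C, hC.2.2, hBC⟩

/-! ### The almost periodic part of the main diagonal -/

theorem IsGood.exists_isAPPart {B : OpN} (hB : IsGood B) : ∃ f, IsAPPart B f := by
  obtain ⟨f, hf, hlim⟩ := hB.2.2 0
  exact ⟨f, hf, (hlim.comp tendsto_natCast_atTop_atTop).congr fun n => by simp [entZ, diagN]⟩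

/-- The difference is almost periodic and tends to `0` at `+∞`, so by recurrence it vanishes. -/
theorem IsAPPart.unique {B : OpN} {f g : ℤ →ᵇ ℂ} (hf : IsAPPart B f) (hg : IsAPPart B g) :
    f = g := by
  have h : Tendsto (fun n : ℕ => (f - g) n) atTop (𝓝 0) := by
    have := hg.2.sub hf.2
    rw [sub_zero] at this
    exact this.congr fun n => by simp
  refine sub_eq_zero.1 (norm_le_zero_iff.1 (le_of_forall_pos_le_add fun ε hε => ?_))
  rw [zero_add]
  refine (BoundedContinuousFunction.norm_le hε.le).2
    (AP_norm_le_of_eventually (AP_sub hf.1 hg.1) ?_)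
  rw [← Nat.map_cast_int_atTop, eventually_map]
  filter_upwards [(Metric.tendsto_nhds.1 h) ε hε] with n hn
  rw [dist_zero_right] at hn
  exact hn.le

theorem IsGood.isAPPart_Dap {B : OpN} (hB : IsGood B) : IsAPPart B (Dap B) :=
  Classical.epsilon_spec hB.exists_isAPPart

/-! ### The homomorphism `W` -/

theorem W_eq_of_isStrongLim {A : FP} {B : OpN} (h : IsStrongLim (fun n => A.1 n) B) : W A = B :=
  ContinuousLinearMap.ext fun x => tendsto_nhds_unique (isStrongLim_W A x) (h x)

theorem norm_extend_apply_le' (A : FP) (n : ℕ+) (x : ℓ²(ℕ, ℂ)) :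
    ‖extend n (A.1 n) x‖ ≤ ‖A.1‖ * ‖x‖ :=
  (norm_extend_apply_le n _ x).trans (mul_le_mul_of_nonneg_right
    (lp.norm_apply_le_norm ENNReal.top_ne_zero A.1 n) (norm_nonneg x))

theorem norm_W_le (A : FP) : ‖W A‖ ≤ ‖A.1‖ :=
  ContinuousLinearMap.opNorm_le_bound _ (norm_nonneg _) fun x =>
    le_of_tendsto (isStrongLim_W A x).norm
      (Eventually.of_forall fun n => norm_extend_apply_le' A n x)

theorem W_add (A B : FP) : W (A + B) = W A + W B :=
  W_eq_of_isStrongLim ((isStrongLim_W A).add (isStrongLim_W B))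

theorem W_mul (A B : FP) : W (A * B) = W A * W B :=
  W_eq_of_isStrongLim (IsStrongLim.mul (lp.norm_apply_le_norm ENNReal.top_ne_zero A.1)
    (isStrongLim_W A) (isStrongLim_W B))

theorem algebraMap_apply (c : ℂ) (n : ℕ+) : (algebraMap ℂ FP c).1 n = c • (1 : OpIm n) := by
  rw [← Algebra.algebraMap_eq_smul_one]
  rfl

theorem W_algebraMap (c : ℂ) : W (algebraMap ℂ FP c) = algebraMap ℂ OpN c := by
  refine W_eq_of_isStrongLim fun x => ?_
  rw [Algebra.algebraMap_eq_smul_one (A := OpN)]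
  exact (IsStrongLim.smul_one c x).congr fun n =>
    congrArg (fun T => extend n T x) (algebraMap_apply c n).symm

theorem norm_extend_sub_le (A C : FP) (n : ℕ+) (x : ℓ²(ℕ, ℂ)) :
    ‖extend n (A.1 n) x - extend n (C.1 n) x‖ ≤ ‖A.1 - C.1‖ * ‖x‖ := by
  have h1 : extend n (A.1 n) x - extend n (C.1 n) x = extend n ((A.1 - C.1) n) x := by
    rw [lp.coeFn_sub, Pi.sub_apply]
    simp [extend]
  rw [h1]
  exact (norm_extend_apply_le n _ x).trans (mul_le_mul_of_nonneg_right
    (lp.norm_apply_le_norm ENNReal.top_ne_zero (A.1 - C.1) n) (norm_nonneg x))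

theorem norm_W_sub_le (A C : FP) : ‖W A - W C‖ ≤ ‖A.1 - C.1‖ :=
  ContinuousLinearMap.opNorm_le_bound _ (norm_nonneg _) fun x =>
    le_of_tendsto ((isStrongLim_W A x).sub (isStrongLim_W C x)).norm
      (Eventually.of_forall fun n => norm_extend_sub_le A C n x)

theorem extend_mul (n : ℕ+) (A B : OpIm n) (x : ℓ²(ℕ, ℂ)) :
    extend n (A * B) x = extend n A (extend n B x) := by
  simp [extend]

theorem extend_star (n : ℕ+) (A : OpIm n) : extend n (star A) = star (extend n A) := by
  rw [ContinuousLinearMap.star_eq_adjoint (extend n A)]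
  refine (ContinuousLinearMap.eq_adjoint_iff _ _).2 fun x y => ?_
  simp only [extend, ContinuousLinearMap.comp_apply, Submodule.subtypeL_apply]
  rw [← Submodule.inner_orthogonalProjectionOnto_eq_of_mem_left,
    ← Submodule.inner_orthogonalProjectionOnto_eq_of_mem_right,
    ContinuousLinearMap.star_eq_adjoint, ContinuousLinearMap.adjoint_inner_left]

/-- Adjoints need not preserve strong limits, but membership in `FP` provides a strong limit of the
adjoints; inner products identify it. -/
theorem W_star (A : FP) : W (star A) = star (W A) := by
  rw [ContinuousLinearMap.star_eq_adjoint (W A)]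
  refine (ContinuousLinearMap.eq_adjoint_iff _ _).2 fun x y => ?_
  have h1 : Tendsto (fun n => inner ℂ (extend n ((star A).1 n) x) y) atTop
      (𝓝 (inner ℂ (W (star A) x) y)) := (isStrongLim_W (star A) x).inner tendsto_const_nhds
  have h2 : Tendsto (fun n => inner ℂ x (extend n (A.1 n) y)) atTop
      (𝓝 (inner ℂ x (W A y))) := tendsto_const_nhds.inner (isStrongLim_W A y)
  refine tendsto_nhds_unique h1 (h2.congr fun n => ?_)
  have h3 : (star A).1 n = star (A.1 n) := rfl
  rw [h3, extend_star, ContinuousLinearMap.star_eq_adjoint,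
    ContinuousLinearMap.adjoint_inner_left]

theorem W_finSecSeq (B : OpN) : W (finSecSeq B) = B :=
  W_eq_of_isStrongLim (isStrongLim_finSec B)

theorem star_finSecSeq (B : OpN) : star (finSecSeq B) = finSecSeq (star B) := by
  refine Subtype.ext (lp.ext (funext fun n => ?_))
  exact star_finSec B n

/-! ### Local convergence of sequences of finite sections -/

/-- The columns of `A_n` are close to those of `W(A)`, uniformly away from the lower right
corner. -/
def LocConv (A : FP) : Prop :=
  ∀ ε > 0, ∃ m : ℕ, ∀ (n : ℕ+) (i : ℕ), i + m < n →
    ‖extend n (A.1 n) (eN i) - W A (eN i)‖ ≤ ε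

theorem eN_mem_imP {n : ℕ+} {i : ℕ} (h : i < n) : eN i ∈ imP n :=
  Submodule.subset_span ⟨i, by simpa using h, rfl⟩

/-- For `i + m < n` the truncated column `w` lies in `im P_n`, so projecting moves only the tail `v
- w`. -/
theorem LocConv.finSecSeq {B : OpN} (hB : ColLoc B) : LocConv (finSecSeq B) := by
  intro ε hε
  obtain ⟨m, hm⟩ := hB (ε / 2) (half_pos hε)
  refine ⟨m, fun n i hi => ?_⟩
  rw [W_finSecSeq]
  set v := B (eN i)
  set w := trunc (Finset.Icc (i - m) (i + m)) v
  have h1 : extend n ((SzegoAP.finSecSeq B).1 n) (eN i) = (imP n).starProjection v := by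
    change (imP n).starProjection (B ((imP n).starProjection (eN i))) = _
    rw [Submodule.starProjection_eq_self_iff.2 (eN_mem_imP (by omega))]
  have hw : w ∈ imP n := by
    simp only [w]
    rw [trunc_eq_sum_eN]
    refine Submodule.sum_mem _ fun j hj => Submodule.smul_mem _ _ (eN_mem_imP ?_)
    rw [Finset.mem_Icc] at hj
    omega
  have h2 : (imP n).starProjection v - v = (imP n).starProjection (v - w) - (v - w) := by
    rw [map_sub, Submodule.starProjection_eq_self_iff.2 hw]
    abel
  rw [h1, h2]
  linarith [norm_sub_le ((imP n).starProjection (v - w)) (v - w),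
    (imP n).norm_starProjection_apply_le (v - w), hm i]

theorem LocConv.of_approx {A : FP} (h : ∀ ε > 0, ∃ C : FP, LocConv C ∧ ‖A.1 - C.1‖ ≤ ε) :
    LocConv A := by
  intro ε hε
  obtain ⟨C, hC, hAC⟩ := h (ε / 3) (by positivity)
  obtain ⟨m, hm⟩ := hC (ε / 3) (by positivity)
  refine ⟨m, fun n i hi => ?_⟩
  have h3 := norm_extend_sub_le A C n (eN i)
  rw [norm_eN, mul_one] at h3
  have h4 : ‖W A (eN i) - W C (eN i)‖ ≤ ‖A.1 - C.1‖ :=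
    (norm_column_le (W A - W C) i).trans (norm_W_sub_le A C)
  rw [norm_sub_rev] at h4
  linarith [hm n i hi,
    norm_sub_le_norm_sub_add_norm_sub (extend n (A.1 n) (eN i)) (extend n (C.1 n) (eN i))
      (W A (eN i)),
    norm_sub_le_norm_sub_add_norm_sub (extend n (C.1 n) (eN i)) (W C (eN i)) (W A (eN i))]

theorem LocConv.add {A B : FP} (hA : LocConv A) (hB : LocConv B) : LocConv (A + B) := by
  intro ε hε
  obtain ⟨m, hm⟩ := hA (ε / 2) (half_pos hε)
  obtain ⟨m', hm'⟩ := hB (ε / 2) (half_pos hε)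
  refine ⟨max m m', fun n i hi => ?_⟩
  have h1 : extend n ((A + B).1 n) (eN i) - W (A + B) (eN i)
      = (extend n (A.1 n) (eN i) - W A (eN i)) + (extend n (B.1 n) (eN i) - W B (eN i)) := by
    have h2 : (A + B).1 n = A.1 n + B.1 n := rfl
    rw [h2, W_add]
    simp only [extend, ContinuousLinearMap.comp_apply, add_apply, map_add]
    abel
  rw [h1]
  refine (norm_add_le _ _).trans ?_
  linarith [hm n i (by omega), hm' n i (by omega)]

/-- To be used with `X = A_n`, `Y = B_n` and strong limits `S`, `T`. The error splits into that of
`Y`, the tail of the column of `T`, and at most `2m + 1` column errors of `X`. -/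
theorem norm_product_column_sub_le {X S Y T : OpN} {a b δ₁ δ₂ δ₃ : ℝ} {i m : ℕ} (hX : ‖X‖ ≤ a)
    (hS : ‖S‖ ≤ a) (hT : ‖T‖ ≤ b) (hδ₃ : 0 ≤ δ₃) (h₁ : ‖Y (eN i) - T (eN i)‖ ≤ δ₁)
    (h₂ : ‖T (eN i) - trunc (Finset.Icc (i - m) (i + m)) (T (eN i))‖ ≤ δ₂)
    (h₃ : ∀ j ∈ Finset.Icc (i - m) (i + m), ‖X (eN j) - S (eN j)‖ ≤ δ₃) :
    ‖X (Y (eN i)) - S (T (eN i))‖ ≤ a * δ₁ + 2 * a * δ₂ + (2 * m + 1) * (b * δ₃) := by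
  have ha : 0 ≤ a := (norm_nonneg X).trans hX
  have hb : 0 ≤ b := (norm_nonneg T).trans hT
  generalize hs : Finset.Icc (i - m) (i + m) = s at h₂ h₃
  generalize hv : T (eN i) = v at h₁ h₂ ⊢
  have h4 : X (Y (eN i)) - S v
      = X (Y (eN i) - v) + (X - S) (v - trunc s v) + ∑ j ∈ s, v j • (X - S) (eN j) := by
    have h5 : ∑ j ∈ s, v j • (X - S) (eN j) = (X - S) (trunc s v) := by
      rw [trunc_eq_sum_eN, map_sum]
      simp only [map_smul]
    rw [h5, map_sub, map_sub, sub_apply X S v]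
    abel
  have e1 : ‖X (Y (eN i) - v)‖ ≤ a * δ₁ :=
    (X.le_opNorm _).trans (mul_le_mul hX h₁ (norm_nonneg _) ha)
  have e2 : ‖(X - S) (v - trunc s v)‖ ≤ 2 * a * δ₂ := by
    refine ((X - S).le_opNorm _).trans (mul_le_mul ?_ h₂ (norm_nonneg _) (by positivity))
    linarith [norm_sub_le X S]
  have e3 : ‖∑ j ∈ s, v j • (X - S) (eN j)‖ ≤ (2 * m + 1) * (b * δ₃) := by
    refine (norm_sum_le_of_le (n := fun _ => b * δ₃) _ fun j hj => ?_).trans ?_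
    · rw [norm_smul, ← hv]
      exact mul_le_mul ((norm_entry_le T j i).trans hT) (h₃ j hj) (norm_nonneg _) hb
    · rw [Finset.sum_const, nsmul_eq_mul, ← hs]
      exact mul_le_mul_of_nonneg_right (card_window_le i m) (by positivity)
  rw [h4]
  exact norm_add₃_le.trans (add_le_add (add_le_add e1 e2) e3)

theorem norm_extend_le (A : FP) (n : ℕ+) : ‖extend n (A.1 n)‖ ≤ ‖A.1‖ :=
  ContinuousLinearMap.opNorm_le_bound _ (norm_nonneg _) (norm_extend_apply_le' A n)

theorem LocConv.mul {A B : FP} (hA : LocConv A) (hB : LocConv B) (hloc : ColLoc (W B)) :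
    LocConv (A * B) := by
  intro ε hε
  obtain ⟨a, ha, hA1, hA2⟩ : ∃ a > 0, (∀ n, ‖extend n (A.1 n)‖ ≤ a) ∧ ‖W A‖ ≤ a :=
    ⟨‖A.1‖ + 1, by positivity, fun n => (norm_extend_le A n).trans (by linarith),
      (norm_W_le A).trans (by linarith)⟩
  obtain ⟨b, hb, hWB⟩ : ∃ b > 0, ‖W B‖ ≤ b := ⟨‖W B‖ + 1, by positivity, by linarith⟩
  obtain ⟨m₁, hm₁⟩ := hB (ε / (3 * a)) (by positivity)
  obtain ⟨m₂, hm₂⟩ := hloc (ε / (6 * a)) (by positivity)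
  obtain ⟨m₃, hm₃⟩ := hA (ε / (3 * ((2 * m₂ + 1) * b))) (by positivity)
  -- Every `j ≤ i + m₂` must still satisfy `j + m₃ < n`, hence the sum. The three tolerances each
  -- contribute `ε / 3`.
  refine ⟨max m₁ (m₂ + m₃), fun n i hi => ?_⟩
  have h1 : extend n ((A * B).1 n) (eN i) = extend n (A.1 n) (extend n (B.1 n) (eN i)) :=
    extend_mul n (A.1 n) (B.1 n) (eN i)
  have h2 : W (A * B) (eN i) = W A (W B (eN i)) := by rw [W_mul]; rfl
  rw [h1, h2]
  refine (norm_product_column_sub_le (hA1 n) hA2 hWB (by positivity) (hm₁ n i (by omega)) (hm₂ i)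
    fun j hj => hm₃ n j ?_).trans (le_of_eq ?_)
  · rw [Finset.mem_Icc] at hj
    omega
  · field_simp
    ring

theorem locConv_algebraMap (c : ℂ) : LocConv (algebraMap ℂ FP c) := by
  intro ε hε
  refine ⟨0, fun n i hi => ?_⟩
  have h2 : extend n (c • (1 : OpIm n)) (eN i) = c • (imP n).starProjection (eN i) := rfl
  have h3 : W (algebraMap ℂ FP c) (eN i) = c • eN i := by
    rw [W_algebraMap, Algebra.algebraMap_eq_smul_one]
    rfl
  rw [algebraMap_apply, h2, h3, Submodule.starProjection_eq_self_iff.2 (eN_mem_imP (by omega)),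
    sub_self, norm_zero]
  exact hε.le

/-- The sequences in the algebra `secAlg` converge locally, and their strong limits belong to the
algebra `opAlg`. -/
theorem locConv_of_mem_secAlg {A : FP} (hA : A ∈ secAlg Set.univ AP) :
    W A ∈ opAlg Set.univ AP ∧ LocConv A := by
  -- Local convergence of columns says nothing about adjoints, so the induction carries it for `star
  -- C` as well.
  have h : ∀ C ∈ StarAlgebra.adjoin ℂ {A : FP | ∃ B ∈ opAlg Set.univ AP, A = finSecSeq B},
      W C ∈ opAlg Set.univ AP ∧ LocConv C ∧ LocConv (star C) := by
    intro C hC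
    induction hC using StarAlgebra.adjoin_induction with
    | mem x hx =>
      obtain ⟨B, hB, rfl⟩ := hx
      have hg := isGood_of_mem_opAlg hB
      exact ⟨by rw [W_finSecSeq]; exact hB, LocConv.finSecSeq hg.1,
        by rw [star_finSecSeq]; exact LocConv.finSecSeq hg.2.1⟩
    | algebraMap c =>
      refine ⟨by rw [W_algebraMap]; exact algebraMap_mem _ c, locConv_algebraMap c, ?_⟩
      rw [← algebraMap_star_comm]
      exact locConv_algebraMap _
    | add x y _ _ hx hy =>
      refine ⟨by rw [W_add]; exact add_mem hx.1 hy.1, hx.2.1.add hy.2.1, ?_⟩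
      rw [show star (x + y) = star x + star y from Subtype.ext (star_add x.1 y.1)]
      exact hx.2.2.add hy.2.2
    | mul x y _ _ hx hy =>
      refine ⟨by rw [W_mul]; exact mul_mem hx.1 hy.1,
        hx.2.1.mul hy.2.1 (isGood_of_mem_opAlg hy.1).1, ?_⟩
      rw [star_mul]
      refine hy.2.2.mul hx.2.2 ?_
      rw [W_star]
      exact (isGood_of_mem_opAlg hx.1).2.1
    | star x _ hx =>
      exact ⟨by rw [W_star]; exact star_mem hx.1, hx.2.2, by rw [star_star]; exact hx.2.1⟩
  have h1 : ∀ ε > 0, ∃ C : FP, (W C ∈ opAlg Set.univ AP ∧ LocConv C) ∧ ‖A.1 - C.1‖ < ε := by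
    intro ε hε
    obtain ⟨C, hC, hAC⟩ := Metric.mem_closure_iff.1 hA ε hε
    refine ⟨C, ⟨(h C hC).1, (h C hC).2.1⟩, ?_⟩
    rw [← dist_eq_norm]
    exact hAC
  constructor
  · have hcl : IsClosed (opAlg Set.univ AP : Set OpN) :=
      StarSubalgebra.isClosed_topologicalClosure _
    -- `W` is contractive and `opAlg` is closed, so membership passes to the limit.
    refine hcl.closure_subset (Metric.mem_closure_iff.2 fun ε hε => ?_)
    obtain ⟨C, hC, hAC⟩ := h1 ε hε
    refine ⟨W C, hC.1, ?_⟩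
    rw [dist_eq_norm]
    exact (norm_W_sub_le A C).trans_lt hAC
  · refine LocConv.of_approx fun ε hε => ?_
    obtain ⟨C, hC, hAC⟩ := h1 ε hε
    exact ⟨C, hC.2, hAC.le⟩

/-! ### Eigenvalue means -/

theorem inner_eN_left (i : ℕ) (x : ℓ²(ℕ, ℂ)) : inner ℂ (eN i) x = x i := by
  rw [eN, lp.inner_single_left]
  simp

/-- The standard basis of `im P_n`. -/
def imPBasis (n : ℕ+) : OrthonormalBasis (Fin n) ℂ (imP n) :=
  OrthonormalBasis.mk (v := fun i : Fin n => (⟨eN i, eN_mem_imP i.2⟩ : imP n))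
    (by
      rw [orthonormal_iff_ite]
      intro i j
      rw [Submodule.coe_inner, inner_eN_left, eN_apply]
      simp [Fin.ext_iff])
    (by
      rw [← Submodule.map_le_map_iff_of_injective (imP n).injective_subtype, Submodule.map_top,
        Submodule.range_subtype, Submodule.map_span]
      refine Submodule.span_mono ?_
      rintro _ ⟨i, hi, rfl⟩
      simp only [Finset.coe_range, Set.mem_Iio] at hi
      exact ⟨_, ⟨⟨i, hi⟩, rfl⟩, rfl⟩)

theorem imPBasis_apply (n : ℕ+) (i : Fin n) : (imPBasis n i : ℓ²(ℕ, ℂ)) = eN i := by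
  simp [imPBasis]

/-- Over `ℂ` the roots of the characteristic polynomial sum to the trace, which is read off in the
standard basis. -/
theorem eigMean_eq {n : ℕ+} (A : OpIm n) :
    eigMean A = (∑ i ∈ Finset.range n, extend n A (eN i) i) / (n : ℕ) := by
  have h1 : (A : imP n →ₗ[ℂ] imP n).charpoly.roots.sum
      = LinearMap.trace ℂ (imP n) (A : imP n →ₗ[ℂ] imP n) := by
    rw [LinearMap.charpoly, ← Matrix.trace_eq_sum_roots_charpoly,
      LinearMap.trace_eq_matrix_trace ℂ (Module.Free.chooseBasis ℂ (imP n))]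
  rw [eigMean, h1, LinearMap.trace_eq_sum_inner _ (imPBasis n), Finset.sum_range]
  congr 1
  refine Finset.sum_congr rfl fun i _ => ?_
  rw [Submodule.coe_inner, imPBasis_apply, inner_eN_left]
  have h2 : (imP n).orthogonalProjectionOnto (eN i) = imPBasis n i := by
    rw [← imPBasis_apply, Submodule.orthogonalProjectionOnto_mem_subspace_eq_self]
  simp [extend, h2]

theorem tendsto_diagonal_mean_sub {A : FP} (hA : LocConv A) :
    Tendsto (fun n : ℕ+ => eigMean (A.1 n)
      - (∑ i ∈ Finset.range n, diagN (W A) i) / (n : ℕ)) atTop (𝓝 0) := by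
  rw [Metric.tendsto_nhds]
  intro ε hε
  obtain ⟨m, hm⟩ := hA (ε / 3) (by positivity)
  -- Beyond `N`, the at most `m` exceptional entries, each off by at most `2 * ‖A.1‖`, contribute
  -- less than `ε / 3` to the mean.
  obtain ⟨N, hN⟩ := exists_nat_gt (m * (2 * ‖A.1‖) / (ε / 3))
  filter_upwards [eventually_ge_atTop (⟨N + 1, N.succ_pos⟩ : ℕ+)] with n hn
  have hn1 : N + 1 ≤ (n : ℕ) := hn
  have hn' : (0 : ℝ) < (n : ℕ) := by exact_mod_cast n.pos
  have hterm : ∀ i ∈ Finset.range n, ‖extend n (A.1 n) (eN i) i - diagN (W A) i‖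
      ≤ ε / 3 + if n ≤ i + m then 2 * ‖A.1‖ else 0 := by
    intro i _
    have h1 : ‖extend n (A.1 n) (eN i) i - diagN (W A) i‖
        ≤ ‖extend n (A.1 n) (eN i) - W A (eN i)‖ :=
      norm_apply_le (extend n (A.1 n) (eN i) - W A (eN i)) i
    refine h1.trans ?_
    split_ifs with hi
    · have h2 := norm_extend_apply_le' A n (eN i)
      rw [norm_eN, mul_one] at h2
      have h3 := (norm_column_le (W A) i).trans (norm_W_le A)
      linarith [norm_sub_le (extend n (A.1 n) (eN i)) (W A (eN i))]
    · linarith [hm n i (by omega)]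
  have hcard : ((Finset.range n).filter fun i => (n : ℕ) ≤ i + m).card ≤ m := by
    refine (Finset.card_le_card (t := Finset.Ico ((n : ℕ) - m) n) fun i hi => ?_).trans ?_
    · rw [Finset.mem_filter, Finset.mem_range] at hi
      rw [Finset.mem_Ico]
      omega
    · rw [Nat.card_Ico]
      omega
  have hcard' : (((Finset.range n).filter fun i => (n : ℕ) ≤ i + m).card : ℝ) ≤ m := by
    exact_mod_cast hcard
  rw [dist_zero_right, eigMean_eq, ← sub_div, ← Finset.sum_sub_distrib, norm_div,
    Complex.norm_natCast, div_lt_iff₀ hn']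
  refine (norm_sum_le_of_le _ hterm).trans_lt ?_
  rw [Finset.sum_add_distrib, Finset.sum_const, Finset.card_range, nsmul_eq_mul,
    ← Finset.sum_filter, Finset.sum_const, nsmul_eq_mul]
  have h4 := mul_le_mul_of_nonneg_right hcard' (by positivity : 0 ≤ 2 * ‖A.1‖)
  have h5 : (N : ℝ) ≤ (n : ℕ) := by exact_mod_cast (Nat.le_succ N).trans hn1
  rw [div_lt_iff₀ (by positivity)] at hN
  nlinarith

/-- The Cesàro means of the null sequence `diagN B - f` vanish in the limit. -/
theorem IsAPPart.tendsto_mean {B : OpN} {f : ℤ →ᵇ ℂ} (h : IsAPPart B f) :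
    Tendsto (fun n : ℕ+ => (∑ i ∈ Finset.range n, diagN B i) / (n : ℕ)) atTop
      (𝓝 (meanValue f)) := by
  have h1 := (h.2.cesaro_smul.comp tendsto_PNat_val_atTop_atTop).add (tendsto_arithMean h.1)
  rw [zero_add] at h1
  refine h1.congr fun n => ?_
  simp only [Function.comp_apply, arithMean, Finset.sum_sub_distrib, Complex.real_smul]
  push_cast
  ring

end SzegoAP

end

theorem theorem4p6 (A : SzegoAP.FP) (hA : A ∈ SzegoAP.secAlg Set.univ SzegoAP.AP) :
    SzegoAP.W A ∈ SzegoAP.opAlg Set.univ SzegoAP.AP ∧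
    (∃! f, SzegoAP.IsAPPart (SzegoAP.W A) f) ∧
    Tendsto (SzegoAP.arithMean (SzegoAP.Dap (SzegoAP.W A))) atTop
      (𝓝 (SzegoAP.meanValue (SzegoAP.Dap (SzegoAP.W A)))) ∧
    Tendsto (fun n : ℕ+ => SzegoAP.eigMean (A.1 n)) atTop
      (𝓝 (SzegoAP.meanValue (SzegoAP.Dap (SzegoAP.W A)))) := by
  obtain ⟨hW, hloc⟩ := SzegoAP.locConv_of_mem_secAlg hA
  have hf := (SzegoAP.isGood_of_mem_opAlg hW).isAPPart_Dap
  refine ⟨hW, ⟨_, hf, fun g hg => hg.unique hf⟩, SzegoAP.tendsto_arithMean hf.1, ?_⟩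
  have h := (SzegoAP.tendsto_diagonal_mean_sub hloc).add hf.tendsto_mean
  rw [zero_add] at h
  exact h.congr fun n => sub_add_cancel _ _
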